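/- Let $n\in\mathbb N$ and let $\mathbb S^n_{++}$ be the manifold of real symmetric positive definite $n\times n$ matrices (the covariance matrices of the non-degenerate Gaussian distributions on $\mathbb R^n$ with a fixed mean), equipped with the Fisher--Rao (FR) metric $$\langle \Omega_1,\Omega_2\rangle_\Sigma=\tfrac12\operatorname{tr}\big(\Omega_1\Sigma^{-1}\Omega_2\Sigma^{-1}\big)$$ for symmetric $\Omega_1,\Omega_2$. Let $d$ be the FR distance $$d(\Sigma_0,\Sigma_1)=\inf_\gamma\int_0^1\sqrt{\langle\gamma'(t),\gamma'(t)\rangle_{\gamma(t)}}\,dt ,$$ where the infimum is over all smooth curves $\gamma:[0,1]\to\mathbb S^n_{++}$ with $\gamma(0)=\Sigma_0$ and $\gamma(1)=\Sigma_1$. Fix $\widehat\Sigma\in\mathbb S^n_{++}$ and $\rho\ge 0$, and let $\mathcal B^{\mathrm{FR}}=\{\Sigma\in\mathbb S^n_{++}: d(\Sigma,\widehat\Sigma)\le\rho\}$. **Lemma (Projection onto $\mathcal B^{\mathrm{FR}}$).** For any $\Sigma'\in\mathbb S^n_{++}$ with $d(\widehat\Sigma,\Sigma')=\rho'$ the following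 hold. (i) The set $\operatorname{arg\,min}_{\Sigma\in\mathcal B^{\mathrm{FR}}} d(\Sigma,\Sigma')$ is a singleton, so the projection $\operatorname{Proj}_{\mathcal B^{\mathrm{FR}}}(\Sigma')$, its unique element, is well-defined. (ii) The projection is given by $$\operatorname{Proj}_{\mathcal B^{\mathrm{FR}}}(\Sigma')=\begin{cases}\widehat\Sigma^{1/2}\big(\widehat\Sigma^{-1/2}\,\Sigma'\,\widehat\Sigma^{-1/2}\big)^{\rho/\rho'}\,\widehat\Sigma^{1/2} & \text{if }\rho'>\rho,\\ \Sigma' & \text{otherwise.}\end{cases}$$ -/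

import Mathlib

open scoped MatrixOrder ContDiff

noncomputable section

namespace FisherRao

variable {n : ℕ}

/-- The Fisher-Rao inner product `⟨Ω₁, Ω₂⟩_Σ = (1/2) tr(Ω₁ Σ⁻¹ Ω₂ Σ⁻¹)` at a positive definite
matrix `Σ` (here `S`), i.e. the Fisher information metric of the Gaussian family with a fixed
mean, parametrized by the covariance matrix. Tangent vectors are symmetric matrices. -/
def inner (S Ω₁ Ω₂ : Matrix (Fin n) (Fin n) ℝ) : ℝ :=
  (1 / 2) * (Ω₁ * S⁻¹ * Ω₂ * S⁻¹).trace

/-- `γ : [0,1] → 𝕊ⁿ₊₊` is a smooth curve from `A` to `B` in the manifold of positive definite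
matrices. (The values of `γ` outside `[0,1]` are irrelevant.) -/
structure IsSmoothCurve (γ : ℝ → Matrix (Fin n) (Fin n) ℝ) (A B : Matrix (Fin n) (Fin n) ℝ) :
    Prop where
  posDef : ∀ t ∈ Set.Icc (0 : ℝ) 1, (γ t).PosDef
  smooth : ∀ i j, ContDiffOn ℝ ∞ (fun t => γ t i j) (Set.Icc 0 1)
  source : γ 0 = A
  target : γ 1 = B

/-- The velocity `γ'(t)`, taken entry by entry (one-sided at the endpoints of `[0,1]`). -/
def velocity (γ : ℝ → Matrix (Fin n) (Fin n) ℝ) (t : ℝ) : Matrix (Fin n) (Fin n) ℝ :=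
  Matrix.of fun i j => derivWithin (fun s => γ s i j) (Set.Icc 0 1) t

/-- The Fisher-Rao length `∫₀¹ √⟨γ'(t), γ'(t)⟩_{γ(t)} dt`. -/
def length (γ : ℝ → Matrix (Fin n) (Fin n) ℝ) : ℝ :=
  ∫ t in (0 : ℝ)..1, Real.sqrt (inner (γ t) (velocity γ t) (velocity γ t))

/-- The Fisher-Rao distance of two positive definite matrices: the infimum of the lengths of the
smooth curves joining them. -/
def dist (A B : Matrix (Fin n) (Fin n) ℝ) : ℝ :=
  sInf {L | ∃ γ, IsSmoothCurve γ A B ∧ L = length γ}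

/-- The Fisher-Rao ball `{S ∈ 𝕊ⁿ₊₊ : d(S, C) ≤ ρ}`. -/
def ball (C : Matrix (Fin n) (Fin n) ℝ) (ρ : ℝ) : Set (Matrix (Fin n) (Fin n) ℝ) :=
  {S | S.PosDef ∧ dist S C ≤ ρ}

/-- The set `argmin_{S ∈ ball C ρ} d(S, P)` of nearest points of the ball to `P`. -/
def projSet (C : Matrix (Fin n) (Fin n) ℝ) (ρ : ℝ) (P : Matrix (Fin n) (Fin n) ℝ) :
    Set (Matrix (Fin n) (Fin n) ℝ) :=
  {S | S ∈ ball C ρ ∧ ∀ T ∈ ball C ρ, dist S P ≤ dist T P}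

end FisherRao

end

noncomputable section

namespace FisherRao

open Matrix Filter Topology

/-! The metric is invariant under congruence `S ↦ G * S * Gᵀ`, so `G = C ^ (-1/2)` moves the centre
of the ball to `1`. There the matrix logarithm compares the geometry with the Euclidean one: up to
the factor `√2` it never increases distances (`norm_logVec_sub_div_le_dist`), and it preserves them
exactly along the powers of a fixed matrix (`dist_rpow_rpow`), in particular distances to `1`.

Hence the ball around `1` is the preimage under `log` of a Euclidean ball around `0`. In Euclidean
space the nearest point to `log P` is the radial one, `t • log P = log (P ^ t)` with `t = ρ / ρ'`,
and at `P ^ t` the comparison loses nothing. So `P ^ t` is a minimizer; the logarithm of any other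
one would be a Euclidean nearest point too, and `log` is injective. -/

/-- A positive definite matrix is orthogonally diagonalizable, compatibly with the continuous
functional calculus. -/
theorem exists_diagonalization {n : ℕ} {A : Matrix (Fin n) (Fin n) ℝ} (hA : A.PosDef) :
    ∃ (U : Matrix (Fin n) (Fin n) ℝ) (a : Fin n → ℝ), Uᵀ * U = 1 ∧ U * Uᵀ = 1 ∧ (∀ i, 0 < a i) ∧
      ∀ f : ℝ → ℝ, cfc f A = U * diagonal (fun i => f (a i)) * Uᵀ := by
  have hU := hA.1.eigenvectorUnitary.2
  rw [Matrix.mem_unitaryGroup_iff, star_eq_conjTranspose, conjTranspose_eq_transpose_of_trivial]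
    at hU
  refine ⟨hA.1.eigenvectorUnitary, hA.1.eigenvalues, mul_eq_one_comm.mp hU, hU, hA.eigenvalues_pos,
    fun f => ?_⟩
  rw [hA.1.cfc_eq, Matrix.IsHermitian.cfc, Unitary.conjStarAlgAut_apply, star_eq_conjTranspose,
    conjTranspose_eq_transpose_of_trivial]
  rfl

theorem cfc_inv_eq {n : ℕ} {A : Matrix (Fin n) (Fin n) ℝ} (hA : A.PosDef) :
    cfc (fun x : ℝ => x⁻¹) A = A⁻¹ := by
  obtain ⟨U, a, h1, h2, ha, hf⟩ := exists_diagonalization hA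
  have hid : A = U * diagonal (fun i => a i) * Uᵀ := by
    rw [← hf fun x => x]
    exact (cfc_id' ℝ A hA.1.isSelfAdjoint).symm
  refine (inv_eq_left_inv ?_).symm
  rw [hf]
  nth_rw 1 [hid]
  calc U * diagonal (fun i => (a i)⁻¹) * Uᵀ * (U * diagonal (fun i => a i) * Uᵀ)
      = U * diagonal (fun i => (a i)⁻¹) * (Uᵀ * U) * diagonal (fun i => a i) * Uᵀ := by
        simp only [Matrix.mul_assoc]
    _ = U * (diagonal (fun i => (a i)⁻¹) * diagonal (fun i => a i)) * Uᵀ := by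
        rw [h1]; simp only [Matrix.mul_assoc, Matrix.one_mul]
    _ = 1 := by
        have : (fun i => (a i)⁻¹ * a i) = fun _ => (1 : ℝ) := by
          ext i; exact inv_mul_cancel₀ (ha i).ne'
        rw [diagonal_mul_diagonal, this, diagonal_one, Matrix.mul_one, h2]

/-- The trace pairing of two functional calculi, in the eigenbases of the two matrices. -/
theorem trace_diagonalized {n : ℕ} (U V D : Matrix (Fin n) (Fin n) ℝ) (a b : Fin n → ℝ) :
    ((U * diagonal a * Uᵀ) * D * (V * diagonal b * Vᵀ) * Dᵀ).trace =
      ∑ i, ∑ j, a i * b j * (Uᵀ * D * V) i j ^ 2 := by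
  have : ((U * diagonal a * Uᵀ) * D * (V * diagonal b * Vᵀ) * Dᵀ).trace =
      (diagonal a * (Uᵀ * D * V) * (diagonal b * (Uᵀ * D * V)ᵀ)).trace := by
    rw [show (U * diagonal a * Uᵀ) * D * (V * diagonal b * Vᵀ) * Dᵀ =
      U * (diagonal a * Uᵀ * D * (V * diagonal b * Vᵀ) * Dᵀ) by simp only [Matrix.mul_assoc],
      Matrix.trace_mul_comm]
    simp only [Matrix.mul_assoc, transpose_mul, transpose_transpose]
  rw [this]
  simp only [trace, diag_apply, Matrix.mul_apply (M := diagonal a * _), diagonal_mul,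
    transpose_apply]
  refine Finset.sum_congr rfl fun i _ => Finset.sum_congr rfl fun j _ => by ring

/-! ### Comparing the logarithm with the metric -/

/-- With `a = exp x`, `b = exp y` and `s = (x - y) / 2` this is `|s| ≤ |sinh s|`. -/
theorem log_sub_log_sq_le {a b : ℝ} (ha : 0 < a) (hb : 0 < b) :
    (Real.log a - Real.log b) ^ 2 ≤ a⁻¹ * b⁻¹ * (a - b) ^ 2 := by
  obtain ⟨x, rfl⟩ : ∃ x, a = Real.exp x := ⟨_, (Real.exp_log ha).symm⟩
  obtain ⟨y, rfl⟩ : ∃ x, b = Real.exp x := ⟨_, (Real.exp_log hb).symm⟩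
  rw [Real.log_exp, Real.log_exp]
  have h : (Real.exp x)⁻¹ * (Real.exp y)⁻¹ * (Real.exp x - Real.exp y) ^ 2 =
      (2 * Real.sinh ((x - y) / 2)) ^ 2 := by
    have e1 : Real.exp x = Real.exp (x / 2) ^ 2 := by rw [← Real.exp_nat_mul]; congr 1; ring
    have e2 : Real.exp y = Real.exp (y / 2) ^ 2 := by rw [← Real.exp_nat_mul]; congr 1; ring
    have e3 : Real.exp ((x - y) / 2) = Real.exp (x / 2) / Real.exp (y / 2) := by
      rw [← Real.exp_sub]; congr 1; ring
    rw [Real.sinh_eq, Real.exp_neg, e3, e1, e2]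
    have := Real.exp_pos (x / 2)
    have := Real.exp_pos (y / 2)
    field_simp
  rw [h, sq_le_sq, abs_mul, abs_two, Real.abs_sinh]
  have := Real.self_le_sinh_iff.2 (abs_nonneg ((x - y) / 2))
  rw [abs_div, abs_two] at this ⊢
  linarith

/-- The matrix logarithm, as a vector of the Euclidean space of matrices. -/
def logVec {n : ℕ} (A : Matrix (Fin n) (Fin n) ℝ) : EuclideanSpace ℝ (Fin n × Fin n) :=
  WithLp.toLp 2 fun p => cfc Real.log A p.1 p.2

theorem norm_logVec_sub_sq {n : ℕ} (A B : Matrix (Fin n) (Fin n) ℝ) :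
    ‖logVec A - logVec B‖ ^ 2 =
      ((cfc Real.log A - cfc Real.log B) * (cfc Real.log A - cfc Real.log B)ᵀ).trace := by
  rw [EuclideanSpace.real_norm_sq_eq, Fintype.sum_prod_type]
  simp [logVec, trace, Matrix.mul_apply, sq]

/-- With rows in an eigenbasis of `A` and columns in one of `B`, `f(B) - f(A)` has entries `(f (b j)
- f (a i)) * (Uᵀ * V) i j`. Taking `f = log` and `f = id` reduces the claim to the scalar
inequality, entry by entry. Being a bound on finite increments, it makes differentiating `log`
unnecessary. -/
theorem norm_logVec_sub_sq_le {n : ℕ} {A B : Matrix (Fin n) (Fin n) ℝ} (hA : A.PosDef)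
    (hB : B.PosDef) :
    ‖logVec A - logVec B‖ ^ 2 ≤ (A⁻¹ * (B - A) * B⁻¹ * (B - A)).trace := by
  obtain ⟨U, a, hU1, hU2, ha, hfa⟩ := exists_diagonalization hA
  obtain ⟨V, b, hV1, hV2, hb, hfb⟩ := exists_diagonalization hB
  have key (f : ℝ → ℝ) (i j) : (Uᵀ * (cfc f B - cfc f A) * V) i j =
      (f (b j) - f (a i)) * (Uᵀ * V) i j := by
    have : Uᵀ * (cfc f B - cfc f A) * V = Uᵀ * V * diagonal (fun i => f (b i)) -
        diagonal (fun i => f (a i)) * (Uᵀ * V) := by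
      rw [hfa, hfb, Matrix.mul_sub, Matrix.sub_mul]
      congr 1
      · simp only [Matrix.mul_assoc, hV1, Matrix.mul_one]
      · simp only [← Matrix.mul_assoc, hU1, Matrix.one_mul]
    rw [this, Matrix.sub_apply, mul_diagonal, diagonal_mul]
    ring
  have hA' : cfc (fun x : ℝ => x) A = A := cfc_id' ℝ A hA.1.isSelfAdjoint
  have hB' : cfc (fun x : ℝ => x) B = B := cfc_id' ℝ B hB.1.isSelfAdjoint
  have hT : (B - A)ᵀ = B - A := by
    have h1 := hA.1.eq
    have h2 := hB.1.eq
    rw [conjTranspose_eq_transpose_of_trivial] at h1 h2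
    rw [transpose_sub, h1, h2]
  have hr : (A⁻¹ * (B - A) * B⁻¹ * (B - A)).trace =
      ∑ i, ∑ j, (a i)⁻¹ * (b j)⁻¹ * ((b j - a i) * (Uᵀ * V) i j) ^ 2 := by
    have := trace_diagonalized U V (B - A) (fun i => (a i)⁻¹) (fun i => (b i)⁻¹)
    rw [← hfa fun x => x⁻¹, ← hfb fun x => x⁻¹, cfc_inv_eq hA, cfc_inv_eq hB, hT] at this
    rw [this]
    have k := key fun x => x
    rw [hA', hB'] at k
    simp only [k]
  have hl : ‖logVec A - logVec B‖ ^ 2 =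
      ∑ i, ∑ j, ((Real.log (b j) - Real.log (a i)) * (Uᵀ * V) i j) ^ 2 := by
    have := trace_diagonalized U V (cfc Real.log B - cfc Real.log A) (fun _ => 1) (fun _ => 1)
    simp only [diagonal_one, Matrix.mul_one, hU2, hV2, one_mul, key] at this
    rw [norm_sub_rev, norm_logVec_sub_sq, this]
  rw [hl, hr]
  refine Finset.sum_le_sum fun i _ => Finset.sum_le_sum fun j _ => ?_
  rw [mul_pow, mul_pow, ← mul_assoc, mul_comm (a i)⁻¹]
  exact mul_le_mul_of_nonneg_right (log_sub_log_sq_le (hb j) (ha i)) (sq_nonneg _)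

theorem continuousAt_inv_of_posDef {n : ℕ} {A : Matrix (Fin n) (Fin n) ℝ} (hA : A.PosDef) :
    ContinuousAt (fun X : Matrix (Fin n) (Fin n) ℝ => X⁻¹) A := by
  refine continuousAt_matrix_inv A ?_
  rw [Ring.inverse_eq_inv']
  exact continuousAt_inv₀ hA.det_pos.ne'

/-! ### Smooth curves and their logarithms -/

namespace IsSmoothCurve

variable {n : ℕ} {γ : ℝ → Matrix (Fin n) (Fin n) ℝ} {A B : Matrix (Fin n) (Fin n) ℝ}

theorem continuousOn (h : IsSmoothCurve γ A B) : ContinuousOn γ (Set.Icc 0 1) :=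
  continuousOn_pi.2 fun i => continuousOn_pi.2 fun j => (h.smooth i j).continuousOn

theorem continuousOn_inv (h : IsSmoothCurve γ A B) :
    ContinuousOn (fun t => (γ t)⁻¹) (Set.Icc 0 1) := fun t ht =>
  (continuousAt_inv_of_posDef (h.posDef t ht)).comp_continuousWithinAt (h.continuousOn t ht)

theorem continuousOn_velocity (h : IsSmoothCurve γ A B) :
    ContinuousOn (velocity γ) (Set.Icc 0 1) :=
  continuousOn_pi.2 fun i => continuousOn_pi.2 fun j =>
    (h.smooth i j).continuousOn_derivWithin (uniqueDiffOn_Icc zero_lt_one) (by simp)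

theorem hasDerivWithinAt (h : IsSmoothCurve γ A B) {t : ℝ} (ht : t ∈ Set.Icc (0 : ℝ) 1)
    (i j : Fin n) :
    HasDerivWithinAt (fun s => γ s i j) (velocity γ t i j) (Set.Icc 0 1) t :=
  (((h.smooth i j).differentiableOn (by simp)) t ht).hasDerivWithinAt

theorem continuousOn_speed (h : IsSmoothCurve γ A B) :
    ContinuousOn (fun t => Real.sqrt (inner (γ t) (velocity γ t) (velocity γ t)))
      (Set.Icc 0 1) := by
  have h1 := h.continuousOn_velocity
  have h2 := h.continuousOn_inv
  refine Real.continuous_sqrt.comp_continuousOn (continuousOn_const.mul ?_)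
  exact (Continuous.matrix_trace continuous_id).comp_continuousOn
    (((h1.mul h2).mul h1).mul h2)

theorem continuousOn_logVec (h : IsSmoothCurve γ A B) :
    ContinuousOn (fun t => logVec (γ t)) (Set.Icc 0 1) := by
  intro x hx
  rw [ContinuousWithinAt, tendsto_iff_norm_sub_tendsto_zero]
  have hc : ContinuousWithinAt (fun t => Real.sqrt
      ((γ t)⁻¹ * (γ x - γ t) * (γ x)⁻¹ * (γ x - γ t)).trace) (Set.Icc 0 1) x := by
    have h1 : ContinuousWithinAt (fun t => γ x - γ t) (Set.Icc 0 1) x :=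
      continuousWithinAt_const.sub (h.continuousOn x hx)
    refine Real.continuous_sqrt.continuousAt.comp_continuousWithinAt ?_
    exact (Continuous.matrix_trace continuous_id).continuousAt.comp_continuousWithinAt
      ((((h.continuousOn_inv x hx).mul h1).mul continuousWithinAt_const).mul h1)
  have hc' := hc.tendsto
  simp only [sub_self, Matrix.mul_zero, trace_zero, Real.sqrt_zero] at hc'
  refine squeeze_zero' (Eventually.of_forall fun _ => norm_nonneg _) ?_ hc'
  filter_upwards [self_mem_nhdsWithin] with t ht
  exact Real.le_sqrt_of_sq_le (norm_logVec_sub_sq_le (h.posDef t ht) (h.posDef x hx))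

/-- The logarithm does not increase speeds. -/
theorem frequently_slope_lt (h : IsSmoothCurve γ A B) {x : ℝ} (hx : x ∈ Set.Ico (0 : ℝ) 1) {r : ℝ}
    (hr : Real.sqrt 2 * Real.sqrt (inner (γ x) (velocity γ x) (velocity γ x)) < r) :
    ∃ᶠ z in 𝓝[>] x, slope (fun t => ‖logVec (γ t) - logVec A‖) x z < r := by
  have hx' : x ∈ Set.Icc (0 : ℝ) 1 := ⟨hx.1, hx.2.le⟩
  have hmem : Set.Icc (0 : ℝ) 1 ∈ 𝓝[>] x := Icc_mem_nhdsGT_of_mem hx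
  let D : ℝ → Matrix (Fin n) (Fin n) ℝ := fun z => (z - x)⁻¹ • (γ z - γ x)
  have hD : Tendsto D (𝓝[>] x) (𝓝 (velocity γ x)) := by
    refine tendsto_pi_nhds.2 fun i => tendsto_pi_nhds.2 fun j => ?_
    have := (h.hasDerivWithinAt hx' i j).mono_of_mem_nhdsWithin hmem
    exact (hasDerivWithinAt_iff_tendsto_slope' (by simp)).1 this
  have hI : Tendsto (fun z => (γ z)⁻¹) (𝓝[>] x) (𝓝 (γ x)⁻¹) :=
    (h.continuousOn_inv x hx').tendsto.mono_left (nhdsWithin_le_of_mem hmem)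
  have hT : Tendsto (fun z => Real.sqrt ((γ x)⁻¹ * D z * (γ z)⁻¹ * D z).trace) (𝓝[>] x)
      (𝓝 (Real.sqrt ((γ x)⁻¹ * velocity γ x * (γ x)⁻¹ * velocity γ x).trace)) := by
    refine (Real.continuous_sqrt.tendsto _).comp ?_
    exact ((Continuous.matrix_trace continuous_id).tendsto _).comp
      (((tendsto_const_nhds.mul hD).mul hI).mul hD)
  -- The `√2` undoes the factor `1/2` in the metric.
  have hval : Real.sqrt ((γ x)⁻¹ * velocity γ x * (γ x)⁻¹ * velocity γ x).trace =
      Real.sqrt 2 * Real.sqrt (inner (γ x) (velocity γ x) (velocity γ x)) := by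
    rw [← Real.sqrt_mul zero_le_two, inner, Matrix.mul_assoc _ (γ x)⁻¹, Matrix.mul_assoc (γ x)⁻¹,
      Matrix.trace_mul_comm (γ x)⁻¹]
    congr 1
    simp only [← Matrix.mul_assoc]
    ring
  rw [hval] at hT
  refine Eventually.frequently ?_
  filter_upwards [hT.eventually (gt_mem_nhds hr), hmem, self_mem_nhdsWithin] with z hz hz1 hzx
  refine lt_of_le_of_lt ?_ hz
  have hpos : 0 < z - x := sub_pos.2 hzx
  rw [slope_def_field, div_eq_inv_mul]
  refine Real.le_sqrt_of_sq_le ?_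
  have h1 : |‖logVec (γ z) - logVec A‖ - ‖logVec (γ x) - logVec A‖| ≤
      ‖logVec (γ x) - logVec (γ z)‖ := by
    have := abs_norm_sub_norm_le (logVec (γ z) - logVec A) (logVec (γ x) - logVec A)
    rwa [sub_sub_sub_cancel_right, norm_sub_rev (logVec (γ z)) (logVec (γ x))] at this
  have h2 := (sq_le_sq.2 (h1.trans (le_abs_self _))).trans
    (norm_logVec_sub_sq_le (h.posDef x hx') (h.posDef z hz1))
  have h3 : ((γ x)⁻¹ * D z * (γ z)⁻¹ * D z).trace =
      (z - x)⁻¹ ^ 2 * ((γ x)⁻¹ * (γ z - γ x) * (γ z)⁻¹ * (γ z - γ x)).trace := by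
    simp only [D, Matrix.mul_smul, Matrix.smul_mul, trace_smul, smul_eq_mul]
    ring
  rw [h3, mul_pow]
  exact mul_le_mul_of_nonneg_left h2 (sq_nonneg _)

/-- A continuous function whose right lower slopes are bounded by the speed grows at most by the
integral of the speed. -/
theorem norm_logVec_sub_le (h : IsSmoothCurve γ A B) :
    ‖logVec B - logVec A‖ ≤ Real.sqrt 2 * length γ := by
  set v : ℝ → ℝ := fun t => Real.sqrt (inner (γ t) (velocity γ t) (velocity γ t)) with hv
  -- A continuous extension of the speed to `ℝ`, so that its primitive is differentiable everywhere,
  -- endpoints included.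
  set w : ℝ → ℝ := Set.IccExtend zero_le_one (Set.domRestrict (Set.Icc 0 1) v) with hw
  have hwc : Continuous w :=
    (continuousOn_iff_continuous_domRestrict.1 h.continuousOn_speed).Icc_extend'
  have hwv : ∀ t ∈ Set.Icc (0 : ℝ) 1, w t = v t := fun t ht => Set.IccExtend_of_mem _ _ ht
  have hlen : length γ = ∫ t in (0 : ℝ)..1, w t := by
    refine intervalIntegral.integral_congr fun t ht => ?_
    rw [Set.uIcc_of_le zero_le_one] at ht
    exact (hwv t ht).symm
  have hderiv : ∀ x, HasDerivAt (fun u => Real.sqrt 2 * ∫ t in (0 : ℝ)..u, w t)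
      (Real.sqrt 2 * w x) x := fun x =>
    (hwc.integral_hasStrictDerivAt 0 x).hasDerivAt.const_mul _
  have := image_le_of_liminf_slope_right_le_deriv_boundary
    (f := fun t => ‖logVec (γ t) - logVec A‖) (a := 0) (b := 1)
    (h.continuousOn_logVec.sub continuousOn_const).norm
    (B := fun u => Real.sqrt 2 * ∫ t in (0 : ℝ)..u, w t) (by simp [h.source])
    (fun x _ => (hderiv x).continuousAt.continuousWithinAt)
    (fun x _ => (hderiv x).hasDerivWithinAt)
    (fun x hx r hr => h.frequently_slope_lt hx (by rwa [hwv x ⟨hx.1, hx.2.le⟩] at hr))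
    (Set.right_mem_Icc.2 zero_le_one)
  rwa [h.target, ← hlen] at this

end IsSmoothCurve

/-! ### The distance and its invariance -/

theorem length_nonneg {n : ℕ} (γ : ℝ → Matrix (Fin n) (Fin n) ℝ) : 0 ≤ length γ :=
  intervalIntegral.integral_nonneg zero_le_one fun _ _ => Real.sqrt_nonneg _

theorem dist_le_length {n : ℕ} {γ : ℝ → Matrix (Fin n) (Fin n) ℝ} {A B : Matrix (Fin n) (Fin n) ℝ}
    (h : IsSmoothCurve γ A B) : dist A B ≤ length γ :=
  csInf_le ⟨0, by rintro _ ⟨γ, -, rfl⟩; exact length_nonneg γ⟩ ⟨γ, h, rfl⟩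

theorem exists_isSmoothCurve {n : ℕ} {A B : Matrix (Fin n) (Fin n) ℝ} (hA : A.PosDef)
    (hB : B.PosDef) : ∃ γ, IsSmoothCurve γ A B := by
  refine ⟨fun t => (1 - t) • A + t • B, fun t ht => ?_, fun i j => ?_, by simp, by simp⟩
  · rcases ht.1.eq_or_lt with rfl | h0
    · simpa using hA
    · exact PosDef.posSemidef_add (hA.posSemidef.smul (sub_nonneg.2 ht.2)) (hB.smul h0)
  · simp only [Matrix.add_apply, Matrix.smul_apply, smul_eq_mul]
    fun_prop

/-- A joining curve must exist, since the real infimum of the empty set is `0`. -/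
theorem le_dist {n : ℕ} {A B : Matrix (Fin n) (Fin n) ℝ} (hA : A.PosDef) (hB : B.PosDef) {c : ℝ}
    (h : ∀ γ, IsSmoothCurve γ A B → c ≤ length γ) : c ≤ dist A B := by
  obtain ⟨γ, hγ⟩ := exists_isSmoothCurve hA hB
  refine le_csInf ⟨_, γ, hγ, rfl⟩ ?_
  rintro _ ⟨γ, hγ, rfl⟩
  exact h γ hγ

/-- The exponential metric increasing property. -/
theorem norm_logVec_sub_div_le_dist {n : ℕ} {A B : Matrix (Fin n) (Fin n) ℝ} (hA : A.PosDef)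
    (hB : B.PosDef) : ‖logVec A - logVec B‖ / Real.sqrt 2 ≤ dist A B :=
  le_dist hA hB fun γ hγ => by
    rw [div_le_iff₀' (by positivity), norm_sub_rev]
    exact hγ.norm_logVec_sub_le

/-- Congruence by `G` conjugates `X * S⁻¹` and `Y * S⁻¹` by `G`, which the trace does not see. -/
theorem inner_congr {n : ℕ} {G : Matrix (Fin n) (Fin n) ℝ} (hG : IsUnit G.det)
    (S X Y : Matrix (Fin n) (Fin n) ℝ) :
    inner (G * S * Gᵀ) (G * X * Gᵀ) (G * Y * Gᵀ) = inner S X Y := by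
  have hG' : IsUnit Gᵀ.det := by rwa [det_transpose]
  have key (Z : Matrix (Fin n) (Fin n) ℝ) :
      G * Z * Gᵀ * (G * S * Gᵀ)⁻¹ = G * (Z * S⁻¹) * G⁻¹ := by
    rw [Matrix.mul_inv_rev, Matrix.mul_inv_rev, Matrix.mul_assoc (G * Z),
      mul_nonsing_inv_cancel_left _ _ hG']
    simp only [Matrix.mul_assoc]
  rw [inner, inner, key, Matrix.mul_assoc _ _ (G * S * Gᵀ)⁻¹, key, Matrix.mul_assoc (G * _),
    ← Matrix.mul_assoc G⁻¹, ← Matrix.mul_assoc G⁻¹, nonsing_inv_mul _ hG, Matrix.one_mul,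
    ← Matrix.mul_assoc, Matrix.trace_mul_comm, Matrix.mul_assoc G,
    nonsing_inv_mul_cancel_left _ _ hG]
  simp only [Matrix.mul_assoc]

theorem posDef_congr {n : ℕ} {G A : Matrix (Fin n) (Fin n) ℝ} (hG : IsUnit G.det) (hA : A.PosDef) :
    (G * A * Gᵀ).PosDef := by
  have := hA.mul_mul_conjTranspose_same (B := G)
    (vecMul_injective_of_isUnit ((isUnit_iff_isUnit_det G).2 hG))
  rwa [conjTranspose_eq_transpose_of_trivial] at this

namespace IsSmoothCurve

variable {n : ℕ} {γ : ℝ → Matrix (Fin n) (Fin n) ℝ} {A B G : Matrix (Fin n) (Fin n) ℝ}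

theorem congr (h : IsSmoothCurve γ A B) (hG : IsUnit G.det) :
    IsSmoothCurve (fun t => G * γ t * Gᵀ) (G * A * Gᵀ) (G * B * Gᵀ) := by
  refine ⟨fun t ht => posDef_congr hG (h.posDef t ht), fun i j => ?_, by rw [h.source],
    by rw [h.target]⟩
  simp only [Matrix.mul_apply]
  exact ContDiffOn.sum fun k _ => (ContDiffOn.sum fun l _ =>
    contDiffOn_const.mul (h.smooth l k)).mul contDiffOn_const

theorem velocity_congr (h : IsSmoothCurve γ A B) (G : Matrix (Fin n) (Fin n) ℝ) {t : ℝ}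
    (ht : t ∈ Set.Icc (0 : ℝ) 1) :
    velocity (fun t => G * γ t * Gᵀ) t = G * velocity γ t * Gᵀ := by
  ext i j
  refine HasDerivWithinAt.derivWithin ?_ (uniqueDiffOn_Icc zero_lt_one t ht)
  simp only [Matrix.mul_apply]
  exact HasDerivWithinAt.fun_sum fun k _ => (HasDerivWithinAt.fun_sum fun l _ =>
    (h.hasDerivWithinAt ht l k).const_mul _).mul_const _

theorem length_congr (h : IsSmoothCurve γ A B) (hG : IsUnit G.det) :
    length (fun t => G * γ t * Gᵀ) = length γ := by
  refine intervalIntegral.integral_congr fun t ht => ?_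
  rw [Set.uIcc_of_le zero_le_one] at ht
  simp only [h.velocity_congr G ht, inner_congr hG]

end IsSmoothCurve

/-- The Fisher-Rao distance is invariant under congruence. -/
theorem dist_congr {n : ℕ} {A B G : Matrix (Fin n) (Fin n) ℝ} (hG : IsUnit G.det)
    (hA : A.PosDef) (hB : B.PosDef) : dist (G * A * Gᵀ) (G * B * Gᵀ) = dist A B := by
  have key {A B G : Matrix (Fin n) (Fin n) ℝ} (hG : IsUnit G.det) (hA : A.PosDef) (hB : B.PosDef) :
      dist (G * A * Gᵀ) (G * B * Gᵀ) ≤ dist A B :=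
    le_dist hA hB fun γ hγ => (hγ.length_congr hG) ▸ dist_le_length (hγ.congr hG)
  refine le_antisymm (key hG hA hB) ?_
  have hinv (A : Matrix (Fin n) (Fin n) ℝ) : G⁻¹ * (G * A * Gᵀ) * G⁻¹ᵀ = A := by
    rw [transpose_nonsing_inv, Matrix.mul_assoc, Matrix.mul_assoc, Matrix.mul_nonsing_inv,
      Matrix.mul_one, nonsing_inv_mul_cancel_left _ _ hG]
    rwa [det_transpose]
  have := key (G := G⁻¹) (isUnit_nonsing_inv_det G hG) (posDef_congr hG hA) (posDef_congr hG hB)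
  rwa [hinv, hinv] at this

/-! ### Exact distances along powers -/

/-- Interpolating the exponents linearly gives a curve of constant speed. -/
theorem dist_diagonal_exp_le {n : ℕ} (u v : Fin n → ℝ) :
    dist (diagonal fun i => Real.exp (u i)) (diagonal fun i => Real.exp (v i)) ≤
      Real.sqrt ((∑ i, (v i - u i) ^ 2) / 2) := by
  set e : ℝ → Fin n → ℝ := fun t i => Real.exp (u i + t * (v i - u i)) with he
  have hd (t : ℝ) (i : Fin n) : HasDerivAt (fun s => e s i) ((v i - u i) * e t i) t := by
    have := (((hasDerivAt_id t).mul_const (v i - u i)).const_add (u i)).exp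
    simpa [he, mul_comm] using this
  have hγ : IsSmoothCurve (fun t => diagonal (e t)) (diagonal fun i => Real.exp (u i))
      (diagonal fun i => Real.exp (v i)) := by
    refine ⟨fun t _ => PosDef.diagonal fun i => Real.exp_pos _, fun i j => ?_, by simp [he],
      by simp [he]⟩
    rcases eq_or_ne i j with rfl | hij
    · simp only [diagonal_apply_eq, he]
      fun_prop
    · simp only [diagonal_apply_ne _ hij]
      exact contDiffOn_const
  have hvel (t : ℝ) (ht : t ∈ Set.Icc (0 : ℝ) 1) : velocity (fun t => diagonal (e t)) t =
      diagonal fun i => (v i - u i) * e t i := by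
    ext i j
    refine HasDerivWithinAt.derivWithin ?_ (uniqueDiffOn_Icc zero_lt_one t ht)
    rcases eq_or_ne i j with rfl | hij
    · simp only [diagonal_apply_eq]
      exact (hd t i).hasDerivWithinAt
    · simp only [diagonal_apply_ne _ hij]
      exact hasDerivWithinAt_const _ _ _
  have hinv (t : ℝ) : (diagonal (e t))⁻¹ = diagonal fun i => (e t i)⁻¹ := by
    refine inv_eq_left_inv ?_
    rw [diagonal_mul_diagonal, ← diagonal_one]
    congr 1
    ext i
    exact inv_mul_cancel₀ (Real.exp_pos _).ne'
  refine (dist_le_length hγ).trans (le_of_eq ?_)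
  have : ∀ t ∈ Set.uIcc (0 : ℝ) 1, Real.sqrt (inner (diagonal (e t))
      (velocity (fun t => diagonal (e t)) t) (velocity (fun t => diagonal (e t)) t)) =
      Real.sqrt ((∑ i, (v i - u i) ^ 2) / 2) := by
    intro t ht
    rw [Set.uIcc_of_le zero_le_one] at ht
    rw [hvel t ht, inner, hinv, diagonal_mul_diagonal, diagonal_mul_diagonal,
      diagonal_mul_diagonal, trace_diagonal, one_div, div_eq_inv_mul]
    congr 2
    refine Finset.sum_congr rfl fun i _ => ?_
    have : e t i ≠ 0 := (Real.exp_pos _).ne'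
    field_simp
  rw [length, intervalIntegral.integral_congr this]
  simp

theorem dist_rpow_rpow_le {n : ℕ} {A : Matrix (Fin n) (Fin n) ℝ} (hA : A.PosDef) (s t : ℝ) :
    dist (A ^ s) (A ^ t) ≤ |t - s| * ‖logVec A‖ / Real.sqrt 2 := by
  obtain ⟨U, a, h1, h2, ha, hf⟩ := exists_diagonalization hA
  have hU : IsUnit U.det := isUnit_det_of_left_inverse h1
  have hpow (r : ℝ) : A ^ r = U * diagonal (fun i => Real.exp (r * Real.log (a i))) * Uᵀ := by
    rw [CFC.rpow_eq_cfc_real hA.posSemidef.nonneg, hf]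
    congr 3
    ext i
    rw [Real.rpow_def_of_pos (ha i), mul_comm]
  have hlog : ‖logVec A‖ ^ 2 = ∑ i, Real.log (a i) ^ 2 := by
    have hl : ‖logVec A‖ ^ 2 = (cfc Real.log A * (cfc Real.log A)ᵀ).trace := by
      rw [EuclideanSpace.real_norm_sq_eq, Fintype.sum_prod_type]
      simp [logVec, trace, Matrix.mul_apply, sq]
    have ht : (cfc Real.log A)ᵀ = cfc Real.log A := by
      rw [hf, transpose_mul, transpose_mul, transpose_transpose, diagonal_transpose,
        Matrix.mul_assoc]
    have := trace_diagonalized U U 1 (fun i => Real.log (a i)) (fun i => Real.log (a i))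
    rw [← hf, Matrix.mul_one, transpose_one, Matrix.mul_one, Matrix.mul_one, h1] at this
    rw [hl, ht, this]
    simp [Matrix.one_apply, sq]
  rw [hpow, hpow, dist_congr hU (PosDef.diagonal fun i => Real.exp_pos _)
    (PosDef.diagonal fun i => Real.exp_pos _)]
  refine (dist_diagonal_exp_le _ _).trans (le_of_eq ?_)
  simp only [← sub_mul, mul_pow, ← Finset.mul_sum, ← hlog]
  rw [Real.sqrt_div (by positivity), ← mul_pow, Real.sqrt_sq_eq_abs, abs_mul, abs_norm]

theorem logVec_rpow {n : ℕ} {A : Matrix (Fin n) (Fin n) ℝ} (hA : A.PosDef) (t : ℝ) :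
    logVec (A ^ t) = t • logVec A := by
  have h : cfc Real.log (A ^ t) = t • cfc Real.log A := by
    -- The spectrum is finite, so every function is continuous on it.
    rw [CFC.rpow_eq_cfc_real hA.posSemidef.nonneg,
      ← cfc_comp' Real.log (fun x => x ^ t) A
        ((finite_real_spectrum.image _).continuousOn _) (finite_real_spectrum.continuousOn _)
        hA.1.isSelfAdjoint,
      ← cfc_smul t Real.log A (finite_real_spectrum.continuousOn _)]
    obtain ⟨U, a, -, -, ha, hf⟩ := exists_diagonalization hA
    rw [hf, hf]
    simp only [Real.log_rpow (ha _), smul_eq_mul]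
  ext p
  simp [logVec, h]

theorem eq_of_logVec_eq {n : ℕ} {A B : Matrix (Fin n) (Fin n) ℝ} (hA : A.PosDef) (hB : B.PosDef)
    (h : logVec A = logVec B) : A = B := by
  have key {A : Matrix (Fin n) (Fin n) ℝ} (hA : A.PosDef) :
      cfc Real.exp (cfc Real.log A) = A := by
    have hid : cfc (fun x : ℝ => x) A = A := cfc_id' ℝ A hA.1.isSelfAdjoint
    conv_rhs => rw [← hid]
    rw [← cfc_comp' Real.exp Real.log A
        ((finite_real_spectrum.image _).continuousOn _) (finite_real_spectrum.continuousOn _)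
        hA.1.isSelfAdjoint]
    obtain ⟨U, a, -, -, ha, hf⟩ := exists_diagonalization hA
    rw [hf, hf]
    simp only [Real.exp_log (ha _)]
  have hlog : cfc Real.log A = cfc Real.log B := by
    ext i j
    exact congrArg (fun v : EuclideanSpace ℝ (Fin n × Fin n) => v (i, j)) h
  rw [← key hA, hlog, key hB]

theorem posDef_rpow {n : ℕ} {A : Matrix (Fin n) (Fin n) ℝ} (hA : A.PosDef) (t : ℝ) :
    (A ^ t).PosDef := by
  obtain ⟨U, a, h1, -, ha, hf⟩ := exists_diagonalization hA
  rw [CFC.rpow_eq_cfc_real hA.posSemidef.nonneg, hf]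
  exact posDef_congr (isUnit_det_of_left_inverse h1)
    (PosDef.diagonal fun i => Real.rpow_pos_of_pos (ha i) t)

theorem rpow_zero_of_posDef {n : ℕ} {A : Matrix (Fin n) (Fin n) ℝ} (hA : A.PosDef) :
    A ^ (0 : ℝ) = 1 := CFC.rpow_zero A hA.posSemidef.nonneg

theorem rpow_one_of_posDef {n : ℕ} {A : Matrix (Fin n) (Fin n) ℝ} (hA : A.PosDef) :
    A ^ (1 : ℝ) = A := CFC.rpow_one A hA.posSemidef.nonneg

/-- The length of the power curve meets the logarithmic lower bound, because `log` sends the powers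
of `A` to a straight line. -/
theorem dist_rpow_rpow {n : ℕ} {A : Matrix (Fin n) (Fin n) ℝ} (hA : A.PosDef) (s t : ℝ) :
    dist (A ^ s) (A ^ t) = |t - s| * ‖logVec A‖ / Real.sqrt 2 := by
  refine le_antisymm (dist_rpow_rpow_le hA s t) ?_
  have := norm_logVec_sub_div_le_dist (posDef_rpow hA s) (posDef_rpow hA t)
  rwa [logVec_rpow hA, logVec_rpow hA, ← sub_smul, norm_smul, Real.norm_eq_abs, abs_sub_comm]
    at this

theorem dist_one_left {n : ℕ} {A : Matrix (Fin n) (Fin n) ℝ} (hA : A.PosDef) :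
    dist 1 A = ‖logVec A‖ / Real.sqrt 2 := by
  simpa [rpow_zero_of_posDef hA, rpow_one_of_posDef hA] using dist_rpow_rpow hA 0 1

theorem dist_one_right {n : ℕ} {A : Matrix (Fin n) (Fin n) ℝ} (hA : A.PosDef) :
    dist A 1 = ‖logVec A‖ / Real.sqrt 2 := by
  simpa [rpow_zero_of_posDef hA, rpow_one_of_posDef hA] using dist_rpow_rpow hA 1 0

theorem dist_self {n : ℕ} {A : Matrix (Fin n) (Fin n) ℝ} (hA : A.PosDef) : dist A A = 0 := by
  simpa [rpow_one_of_posDef hA] using dist_rpow_rpow hA 1 1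

/-! ### Projection onto a ball -/

/-- In a Euclidean space, the nearest point to `y` of a ball around the origin not containing `y`
is unique. -/
theorem eq_smul_of_norm_sub_le {E : Type*} [NormedAddCommGroup E] [InnerProductSpace ℝ E]
    {x y : E} {r : ℝ} (hr : 0 ≤ r) (hy : r < ‖y‖) (hx : ‖x‖ ≤ r) (hxy : ‖x - y‖ ≤ ‖y‖ - r) :
    x = (r / ‖y‖) • y := by
  have h1 := norm_sub_norm_le y x
  rw [norm_sub_rev] at h1
  have hxr : ‖x‖ = r := by linarith
  -- Equality in the reverse triangle inequality puts `x` and `y` on one ray.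
  have h2 : ‖x - y‖ = |‖x‖ - ‖y‖| := by
    rw [abs_of_nonpos (by linarith)]
    linarith
  have h3 := (sameRay_iff_norm_sub.2 h2).norm_smul_eq
  have hy0 : ‖y‖ ≠ 0 := (hr.trans_lt hy).ne'
  rw [hxr] at h3
  rw [div_eq_inv_mul, mul_smul, h3, smul_smul, inv_mul_cancel₀ hy0, one_smul]

theorem projSet_one_of_le {n : ℕ} {P : Matrix (Fin n) (Fin n) ℝ} (hP : P.PosDef) {ρ : ℝ}
    (h : dist 1 P ≤ ρ) : projSet 1 ρ P = {P} := by
  -- Only symmetry about `1` is needed: both orders give the same norm of the logarithm.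
  have hmem : P ∈ ball 1 ρ := ⟨hP, by rwa [dist_one_right hP, ← dist_one_left hP]⟩
  ext S
  rw [Set.mem_singleton_iff]
  constructor
  · rintro ⟨⟨hS, -⟩, hmin⟩
    have h1 := (norm_logVec_sub_div_le_dist hS hP).trans (hmin P hmem)
    rw [dist_self hP, div_le_iff₀ (by positivity), zero_mul] at h1
    exact eq_of_logVec_eq hS hP (sub_eq_zero.1 (norm_le_zero_iff.1 h1))
  · rintro rfl
    refine ⟨hmem, fun T hT => ?_⟩
    rw [dist_self hP]
    exact (by positivity : (0 : ℝ) ≤ _).trans (norm_logVec_sub_div_le_dist hT.1 hP)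

theorem projSet_one_of_lt {n : ℕ} {P : Matrix (Fin n) (Fin n) ℝ} (hP : P.PosDef) {ρ : ℝ}
    (hρ : 0 ≤ ρ) (h : ρ < dist 1 P) : projSet 1 ρ P = {P ^ (ρ / dist 1 P)} := by
  have h2 : (0 : ℝ) < Real.sqrt 2 := by positivity
  set t := ρ / dist 1 P with ht
  have hd : 0 < dist 1 P := hρ.trans_lt h
  have ht0 : 0 ≤ t := by positivity
  have ht1 : t ≤ 1 := (div_le_one hd).2 h.le
  have htd : t * dist 1 P = ρ := div_mul_cancel₀ _ hd.ne'
  have hmem : P ^ t ∈ ball 1 ρ := by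
    refine ⟨posDef_rpow hP t, le_of_eq ?_⟩
    have := dist_rpow_rpow hP t 0
    rw [rpow_zero_of_posDef hP, zero_sub, abs_neg, abs_of_nonneg ht0, mul_div_assoc,
      ← dist_one_left hP, htd] at this
    exact this
  have hdist : dist (P ^ t) P = dist 1 P - ρ := by
    have := dist_rpow_rpow hP t 1
    rw [rpow_one_of_posDef hP, abs_of_nonneg (sub_nonneg.2 ht1), mul_div_assoc,
      ← dist_one_left hP, sub_mul, one_mul, htd] at this
    exact this
  have hnorm : ‖logVec P‖ = Real.sqrt 2 * dist 1 P := by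
    rw [dist_one_left hP]; field_simp
  have hball {T : Matrix (Fin n) (Fin n) ℝ} (hT : T ∈ ball 1 ρ) :
      ‖logVec T‖ ≤ Real.sqrt 2 * ρ := by
    have := hT.2
    rwa [dist_one_right hT.1, div_le_iff₀' h2] at this
  ext S
  rw [Set.mem_singleton_iff]
  constructor
  · rintro ⟨hS, hmin⟩
    have h1 := (norm_logVec_sub_div_le_dist hS.1 hP).trans (hmin _ hmem)
    rw [hdist, div_le_iff₀' h2, mul_sub, ← hnorm] at h1
    refine eq_of_logVec_eq hS.1 (posDef_rpow hP t) ?_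
    rw [eq_smul_of_norm_sub_le (by positivity) (by rw [hnorm]; gcongr) (hball hS) h1,
      logVec_rpow hP, hnorm, mul_div_mul_left _ _ h2.ne']
  · rintro rfl
    refine ⟨hmem, fun T hT => ?_⟩
    -- The triangle inequality for logarithms already gives the value attained at `P ^ t`.
    refine le_trans ?_ (norm_logVec_sub_div_le_dist hT.1 hP)
    rw [hdist, le_div_iff₀' h2, mul_sub, ← hnorm, norm_sub_rev]
    have := norm_sub_norm_le (logVec P) (logVec T)
    have := hball hT
    linarith

/-- Congruence by `G` is an isometric bijection of the positive definite matrices, with inverse the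
congruence by `G⁻¹`. -/
theorem mem_projSet_congr {n : ℕ} {G C P S : Matrix (Fin n) (Fin n) ℝ} {ρ : ℝ}
    (hG : IsUnit G.det) (hC : C.PosDef) (hP : P.PosDef) :
    G * S * Gᵀ ∈ projSet (G * C * Gᵀ) ρ (G * P * Gᵀ) ↔ S ∈ projSet C ρ P := by
  have hinv (A : Matrix (Fin n) (Fin n) ℝ) : G * (G⁻¹ * A * G⁻¹ᵀ) * Gᵀ = A := by
    rw [transpose_nonsing_inv, Matrix.mul_assoc, Matrix.mul_assoc, Matrix.nonsing_inv_mul,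
      Matrix.mul_one, mul_nonsing_inv_cancel_left _ _ hG]
    rwa [det_transpose]
  have hinv' (A : Matrix (Fin n) (Fin n) ℝ) : G⁻¹ * (G * A * Gᵀ) * G⁻¹ᵀ = A := by
    rw [transpose_nonsing_inv, Matrix.mul_assoc, Matrix.mul_assoc, Matrix.mul_nonsing_inv,
      Matrix.mul_one, nonsing_inv_mul_cancel_left _ _ hG]
    rwa [det_transpose]
  have hpos (A : Matrix (Fin n) (Fin n) ℝ) : (G * A * Gᵀ).PosDef ↔ A.PosDef :=
    ⟨fun h => hinv' A ▸ posDef_congr (isUnit_nonsing_inv_det G hG) h, posDef_congr hG⟩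
  have hball (A : Matrix (Fin n) (Fin n) ℝ) : G * A * Gᵀ ∈ ball (G * C * Gᵀ) ρ ↔ A ∈ ball C ρ := by
    rw [ball, ball, Set.mem_ofPred_eq, Set.mem_ofPred_eq, hpos, and_congr_right_iff]
    intro h
    rw [dist_congr hG h hC]
  constructor
  · rintro ⟨hS, hmin⟩
    have hS' := (hball S).1 hS
    refine ⟨hS', fun T hT => ?_⟩
    have := hmin _ ((hball T).2 hT)
    rwa [dist_congr hG hS'.1 hP, dist_congr hG hT.1 hP] at this
  · rintro ⟨hS, hmin⟩
    refine ⟨(hball S).2 hS, fun T hT => ?_⟩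
    rw [← hinv T, hball] at hT
    rw [← hinv T, dist_congr hG hS.1 hP, dist_congr hG hT.1 hP]
    exact hmin _ hT

end FisherRao

end

open FisherRao Matrix in
theorem mainTheorem4 (n : ℕ) (C P : Matrix (Fin n) (Fin n) ℝ) (hC : C.PosDef) (hP : P.PosDef)
    (ρ ρ' : ℝ) (hρ : 0 ≤ ρ) (hρ' : FisherRao.dist C P = ρ') :
    (∃! S, S ∈ FisherRao.projSet C ρ P) ∧
    (ρ' ≤ ρ → FisherRao.projSet C ρ P = {P}) ∧
    (ρ < ρ' → FisherRao.projSet C ρ P =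
      {C ^ (1 / 2 : ℝ) * (C ^ (-(1 / 2) : ℝ) * P * C ^ (-(1 / 2) : ℝ)) ^ (ρ / ρ') *
        C ^ (1 / 2 : ℝ)}) := by
  set G := C ^ (-(1 / 2) : ℝ) with hGdef
  set K := C ^ (1 / 2 : ℝ) with hKdef
  have hCu : IsUnit C := (isUnit_iff_isUnit_det C).2 hC.det_pos.ne'.isUnit
  have hGK : G * K = 1 := by
    rw [hGdef, hKdef, ← CFC.rpow_add hCu, neg_add_cancel, rpow_zero_of_posDef hC]
  have hKG : K * G = 1 := mul_eq_one_comm.1 hGK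
  have hG : IsUnit G.det := isUnit_det_of_right_inverse hGK
  have hGT : Gᵀ = G := by
    have := (posDef_rpow hC (-(1 / 2))).1.eq
    rwa [conjTranspose_eq_transpose_of_trivial] at this
  have hKK : K * K = C := by
    rw [hKdef, ← CFC.rpow_add hCu, add_halves, rpow_one_of_posDef hC]
  have hGCG : G * C * Gᵀ = 1 := by
    rw [hGT, ← hKK, ← Matrix.mul_assoc, hGK, Matrix.one_mul, hKG]
  have hQ : (G * P * Gᵀ).PosDef := posDef_congr hG hP
  have hd : dist 1 (G * P * Gᵀ) = ρ' := by rw [← hGCG, dist_congr hG hC hP, hρ']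
  -- Carries the projection found at centre `1` back to centre `C`.
  have hsolve (S T : Matrix (Fin n) (Fin n) ℝ) : G * S * Gᵀ = T ↔ S = K * T * K := by
    rw [hGT]
    constructor
    · rintro rfl
      rw [Matrix.mul_assoc, Matrix.mul_assoc, hGK, Matrix.mul_one, ← Matrix.mul_assoc, hKG,
        Matrix.one_mul]
    · rintro rfl
      rw [Matrix.mul_assoc, Matrix.mul_assoc, hKG, Matrix.mul_one, ← Matrix.mul_assoc, hGK,
        Matrix.one_mul]
  have hle (h : ρ' ≤ ρ) : projSet C ρ P = {P} := by
    ext S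
    rw [← mem_projSet_congr hG hC hP, hGCG, projSet_one_of_le hQ (hd.trans_le h),
      Set.mem_singleton_iff, hsolve, Set.mem_singleton_iff, ← (hsolve P _).1 rfl]
  have hlt (h : ρ < ρ') : projSet C ρ P = {K * (G * P * G) ^ (ρ / ρ') * K} := by
    ext S
    rw [← mem_projSet_congr hG hC hP, hGCG, projSet_one_of_lt hQ hρ (h.trans_eq hd.symm), hd,
      Set.mem_singleton_iff, hsolve, Set.mem_singleton_iff, hGT]
  refine ⟨?_, hle, hlt⟩
  rcases le_or_gt ρ' ρ with h | h
  · rw [hle h]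
    exact ⟨_, rfl, fun _ => id⟩
  · rw [hlt h]
    exact ⟨_, rfl, fun _ => id⟩
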